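/- Consider a completely randomized experiment on $N$ units with fixed potential outcomes $Y_i(1),Y_i(0)\in\mathbb R$ ($i=1,\dots,N$): $N_1$ units are treated and $N_0=N-N_1$ are controls, $0<N_1<N$, and the assignment vector $\boldsymbol T=(T_1,\dots,T_N)\in\{0,1\}^N$ is uniformly distributed on the vectors with $\sum_i T_i=N_1$. Let $Y_i^{obs}=T_iY_i(1)+(1-T_i)Y_i(0)$, $\bar Y^{obs}=\frac1N\sum_{i=1}^N Y_i^{obs}$, $s^2=\frac1{N-1}\sum_{i=1}^N(Y_i^{obs}-\bar Y^{obs})^2$, $$\widehat\tau(\boldsymbol T,\boldsymbol Y^{obs})=\frac1{N_1}\sum_{i:T_i=1}Y_i^{obs}-\frac1{N_0}\sum_{i:T_i=0}Y_i^{obs},\qquad \widehat V(\mathrm{Fisher})=\frac{N s^2}{N_1N_0}.$$ Assume Fisher's sharp null hypothesis, $Y_i(1)=Y_i(0)$ for all $i=1,\dots,N$, so that $Y_i^{obs}$, $s^2$ and $\widehat V(\mathrm{Fisher})$ do not depend on $\boldsymbol T$. Then $$E\{\widehat\tau(\boldsymbol T,\boldsymbol Y^{obs})\}=0,\qquad \operatorname{var}\{\widehat\tau(\boldsymbol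 T,\boldsymbol Y^{obs})\}=\widehat V(\mathrm{Fisher}).$$ Moreover, along any sequence of such experiments, each satisfying the sharp null, with $N\to\infty$, $N_1/N\to c$ for some $c\in(0,1)$, and with $$\frac{\max_{1\le i\le N}(Y_i^{obs}-\bar Y^{obs})^2}{\frac1N\sum_{i=1}^N(Y_i^{obs}-\bar Y^{obs})^2}$$ well defined (nonzero denominator) and bounded for all sufficiently large indices of the sequence, we have $$\frac{\widehat\tau(\boldsymbol T,\boldsymbol Y^{obs})}{\sqrt{\widehat V(\mathrm{Fisher})}}\stackrel{d}{\longrightarrow}\mathcal N(0,1).$$ -/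

import Mathlib

open Filter Topology MeasureTheory ProbabilityTheory

noncomputable section

/-- Mean `∑ x i / N` of a finite population. -/
def popMean {N : ℕ} (x : Fin N → ℝ) : ℝ := (∑ i, x i) / N

/-- Finite-population variance `∑ (x i - mean)² / (N - 1)`. -/
def popVar {N : ℕ} (x : Fin N → ℝ) : ℝ := (∑ i, (x i - popMean x) ^ 2) / ((N : ℝ) - 1)

/-- A completely randomized experiment on `N` units, `N₁` of which are treated, with both arms
nonempty; `Y a i` is the (fixed) potential outcome of unit `i` under treatment level `a`
(`1` for treatment, `0` for control). -/
structure CRExperiment where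
  N : ℕ
  N₁ : ℕ
  N₁_pos : 0 < N₁
  N₁_lt : N₁ < N
  Y : Fin 2 → Fin N → ℝ

namespace CRExperiment

variable (E : CRExperiment)

/-- Number of control units. -/
def N₀ : ℕ := E.N - E.N₁

/-- The assignment vectors `t ∈ {0,1}^N` with exactly `N₁` treated units. -/
def assignments : Set (Fin E.N → Fin 2) :=
  {t | (Finset.univ.filter fun i => t i = 1).card = E.N₁}

/-- Law of the treatment assignment vector: uniform on the assignments with `N₁` treated units,
that is, each has probability `N₁! N₀! / N!`. -/
def law : Measure (Fin E.N → Fin 2) := uniformOn E.assignments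

/-- Observed outcomes under assignment `t`: `Y_i^obs = t_i Y_i(1) + (1 - t_i) Y_i(0)`. -/
def Yobs (t : Fin E.N → Fin 2) : Fin E.N → ℝ := fun i => E.Y (t i) i

/-- Difference in means of the outcome vector `y` between the two arms of the assignment `t`. -/
def diffInMeans (t : Fin E.N → Fin 2) (y : Fin E.N → ℝ) : ℝ :=
  (∑ i with t i = 1, y i) / E.N₁ - (∑ i with t i = 0, y i) / E.N₀

/-- Fisher's variance `N s² / (N₁ N₀)` computed from the outcome vector `y`. -/
def fisherVar (y : Fin E.N → ℝ) : ℝ := E.N * popVar y / (E.N₁ * E.N₀)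

/-- Fisher's sharp null hypothesis: `Y_i(1) = Y_i(0)` for every unit. -/
def SharpNull : Prop := ∀ i, E.Y 1 i = E.Y 0 i

instance isProbabilityMeasure_law : IsProbabilityMeasure E.law := by
  refine isProbabilityMeasure_uniformOn (Set.toFinite _) ?_
  obtain ⟨s, -, hs⟩ := Finset.exists_subset_card_eq
    (s := (Finset.univ : Finset (Fin E.N))) (n := E.N₁) (by simpa using E.N₁_lt.le)
  refine ⟨fun i => if i ∈ s then 1 else 0, ?_⟩
  simp [assignments, hs]

end CRExperiment

/-- Along the sequence of populations `x k`, the ratio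
`max_i (x_i - mean)² / (∑_i (x_i - mean)² / N)` is well defined (the populations are not constant)
and bounded, from some index on. -/
def BoundedMaxRatio {N : ℕ → ℕ} (x : (k : ℕ) → Fin (N k) → ℝ) : Prop :=
  ∃ B : ℝ, ∀ᶠ k in atTop,
    0 < ∑ i, (x k i - popMean (x k)) ^ 2 ∧
    ∀ i, (x k i - popMean (x k)) ^ 2 / ((∑ j, (x k j - popMean (x k)) ^ 2) / N k) ≤ B

end

/-!
Under the sharp null the outcome vector `y` is fixed, and on the support of the randomization law the
difference in means is `N / (N₁ N₀)` times the sum of `yᵢ - ȳ` over the treated units: a linear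
statistic of a simple random sample without replacement (`CRExperiment.diffInMeans_eq`).

*Moments.* The law is invariant under permutations of the units, so all `E Tᵢ` agree, as do all
`E TᵢTⱼ` with `i ≠ j`; the constraint `∑ Tᵢ = N₁` then determines both. For centred weights this gives
the mean and the variance of the linear statistic (`CRExperiment.integral_treatedSum_sq`).

*Normal limit.* Simple random sampling is independent Bernoulli sampling, with `p = N₁ / N`,
conditioned on the sample size being `N₁`, and the conditioning can be performed by Fourier inversion
in an additional frequency `θ` (the Erdős–Rényi argument). If `φ` is the characteristic function of a
centred Bernoulli variable, then for centred weights `b` the characteristic function of the linear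
statistic is (`CRExperiment.integral_exp_treatedSum`)

  `(∫_{-π}^{π} ∏ᵢ φ (bᵢ + θ) dθ) / (∫_{-π}^{π} φ(θ) ^ N dθ)`.

After the substitution `θ = s / √N`, a Taylor expansion of `φ` shows that the product tends to
`exp (-c (1 - c) (v + s²) / 2)`, where `v = lim ∑ bᵢ²`: the cross term vanishes because `∑ bᵢ = 0`,
and the bound on the maximum ratio makes all arguments of `φ` small. A Gaussian bound on `|φ|`, valid
on the whole range of integration, dominates the integrands, so both integrals converge
(`tendsto_sqrt_mul_integral_prod_bernChar`); the denominator is the case `b = 0`, so no local limit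
theorem for the sample size is needed. The quotient tends to `exp (-c (1 - c) v / 2)`. For the
standardized difference in means `v = 1 / (c (1 - c))`, and Lévy's continuity theorem concludes.
-/

/-! ### The characteristic function of a centred Bernoulli variable -/

/-- The characteristic function at `u` of `T - p`, where `T` is a Bernoulli variable with success
probability `p`. -/
noncomputable def bernChar (p u : ℝ) : ℂ :=
  ((1 - p : ℝ) : ℂ) * Complex.exp ((-(p * u) : ℝ) * Complex.I) +
    (p : ℂ) * Complex.exp (((1 - p) * u : ℝ) * Complex.I)

lemma continuous_bernChar (p : ℝ) : Continuous (bernChar p) := by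
  unfold bernChar
  fun_prop

lemma norm_sq_bernChar (p u : ℝ) :
    ‖bernChar p u‖ ^ 2 = 1 - 2 * (p * (1 - p)) * (1 - Real.cos u) := by
  have h : bernChar p u = Complex.exp ((-(p * u) : ℝ) * Complex.I) *
      (((1 - p : ℝ) : ℂ) + (p : ℂ) * Complex.exp ((u : ℂ) * Complex.I)) := by
    rw [bernChar, mul_add, mul_left_comm, ← Complex.exp_add]
    push_cast
    ring_nf
  rw [h, norm_mul, Complex.norm_exp_ofReal_mul_I, one_mul, ← Complex.normSq_eq_norm_sq,
    Complex.normSq_apply]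
  simp only [Complex.add_re, Complex.add_im, Complex.mul_re, Complex.mul_im, Complex.ofReal_re,
    Complex.ofReal_im, Complex.exp_ofReal_mul_I_re, Complex.exp_ofReal_mul_I_im]
  linear_combination p ^ 2 * Real.sin_sq_add_cos_sq u

lemma norm_bernChar_le_one {p : ℝ} (hp : p ∈ Set.Icc (0 : ℝ) 1) (u : ℝ) : ‖bernChar p u‖ ≤ 1 := by
  rw [← sq_le_one_iff₀ (norm_nonneg _), norm_sq_bernChar]
  have h₁ : 0 ≤ p * (1 - p) := mul_nonneg hp.1 (by linarith [hp.2])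
  have h₂ : 0 ≤ 1 - Real.cos u := by linarith [Real.cos_le_one u]
  nlinarith [mul_nonneg h₁ h₂]

/-- The range `[-3π/2, 3π/2]`, larger than a period, leaves room for arguments `b + θ` with
`|θ| ≤ π` and `b` small. -/
lemma mul_sq_le_one_sub_cos {u : ℝ} (hu : |u| ≤ 3 * Real.pi / 2) :
    4 / (9 * Real.pi ^ 2) * u ^ 2 ≤ 1 - Real.cos u := by
  have hpi := Real.pi_pos
  rcases le_total |u| Real.pi with h | h
  · have h₁ := Real.cos_le_one_sub_mul_cos_sq h
    have h₂ : 4 / (9 * Real.pi ^ 2) * u ^ 2 ≤ 2 / Real.pi ^ 2 * u ^ 2 := by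
      have : 4 / (9 * Real.pi ^ 2) ≤ 2 / Real.pi ^ 2 := by
        rw [div_le_div_iff₀ (by positivity) (by positivity)]
        nlinarith [sq_nonneg Real.pi]
      gcongr
    linarith
  · have hcos : Real.cos u ≤ 0 := by
      rw [← Real.cos_abs]
      exact Real.cos_nonpos_of_pi_div_two_le_of_le (by linarith) (by linarith)
    have h₂ : 4 / (9 * Real.pi ^ 2) * u ^ 2 ≤ 1 := by
      have := pow_le_pow_left₀ (abs_nonneg u) hu 2
      rw [sq_abs] at this
      rw [div_mul_eq_mul_div, div_le_one (by positivity)]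
      linarith
    linarith

lemma norm_bernChar_le_exp {p u : ℝ} (hp : p ∈ Set.Icc (0 : ℝ) 1) (hu : |u| ≤ 3 * Real.pi / 2) :
    ‖bernChar p u‖ ≤ Real.exp (-(p * (1 - p) * (4 / (9 * Real.pi ^ 2)) * u ^ 2)) := by
  have h₁ : 0 ≤ p * (1 - p) := mul_nonneg hp.1 (by linarith [hp.2])
  refine le_of_sq_le_sq ?_ (Real.exp_pos _).le
  rw [norm_sq_bernChar, ← Real.exp_nat_mul]
  refine le_trans ?_ (Real.add_one_le_exp _)
  have := mul_le_mul_of_nonneg_left (mul_sq_le_one_sub_cos hu) h₁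
  push_cast
  linarith

lemma norm_exp_ofReal_mul_I_sub_le {x : ℝ} (hx : |x| ≤ 1) :
    ‖Complex.exp (x * Complex.I) - (1 + x * Complex.I - x ^ 2 / 2)‖ ≤ |x| ^ 3 := by
  have h := Complex.exp_bound (x := x * Complex.I) (by simpa using hx) (n := 3) (by norm_num)
  have hI : ∑ m ∈ Finset.range 3, ((x : ℂ) * Complex.I) ^ m / m.factorial =
      1 + x * Complex.I - x ^ 2 / 2 := by
    simp [Finset.sum_range_succ, mul_pow, Nat.factorial]
    ring
  rw [hI] at h
  refine h.trans ?_
  simp only [norm_mul, Complex.norm_real, Complex.norm_I, mul_one, Real.norm_eq_abs]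
  have : 0 ≤ |x| ^ 3 := by positivity
  norm_num [Nat.factorial]
  linarith

/-- Second-order Taylor expansion, compared with a Gaussian. -/
lemma norm_bernChar_sub_exp_le {p u : ℝ} (hp : p ∈ Set.Icc (0 : ℝ) 1) (hu : |u| ≤ 1) :
    ‖bernChar p u - Real.exp (-(p * (1 - p) * u ^ 2 / 2))‖ ≤ 3 * |u| ^ 3 := by
  obtain ⟨hp₀, hp₁⟩ := hp
  have hq₀ : 0 ≤ 1 - p := by linarith
  have hu3 : 0 ≤ |u| ^ 3 := by positivity
  have e₁ : |(-(p * u))| ≤ |u| := by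
    rw [abs_neg, abs_mul, abs_of_nonneg hp₀]
    exact mul_le_of_le_one_left (abs_nonneg _) hp₁
  have e₂ : |(1 - p) * u| ≤ |u| := by
    rw [abs_mul, abs_of_nonneg hq₀]
    exact mul_le_of_le_one_left (abs_nonneg _) (by linarith)
  have r₁ := (norm_exp_ofReal_mul_I_sub_le (e₁.trans hu)).trans
    (pow_le_pow_left₀ (abs_nonneg _) e₁ 3)
  have r₂ := (norm_exp_ofReal_mul_I_sub_le (e₂.trans hu)).trans
    (pow_le_pow_left₀ (abs_nonneg _) e₂ 3)
  have hpq : p * (1 - p) ≤ 1 := by nlinarith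
  have hpq₀ : 0 ≤ p * (1 - p) := by positivity
  have hx₀ : 0 ≤ p * (1 - p) * u ^ 2 / 2 := by positivity
  have hux : p * (1 - p) * u ^ 2 / 2 ≤ |u| ^ 2 := by
    rw [sq_abs]
    nlinarith [mul_le_mul_of_nonneg_right hpq (sq_nonneg u), sq_nonneg u]
  have hu2 : |u| ^ 2 ≤ 1 := pow_le_one₀ (abs_nonneg _) hu
  have r₃ : |Real.exp (-(p * (1 - p) * u ^ 2 / 2)) - 1 - -(p * (1 - p) * u ^ 2 / 2)| ≤ |u| ^ 3 := by
    refine (Real.abs_exp_sub_one_sub_id_le (by rw [abs_neg, abs_of_nonneg hx₀]; linarith)).trans ?_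
    rw [neg_sq]
    calc (p * (1 - p) * u ^ 2 / 2) ^ 2 ≤ (|u| ^ 2) ^ 2 := pow_le_pow_left₀ hx₀ hux 2
      _ = |u| ^ 3 * |u| := by ring
      _ ≤ |u| ^ 3 := mul_le_of_le_one_right hu3 hu
  rw [← Real.norm_eq_abs, ← Complex.norm_real] at r₃
  -- The quadratic Taylor polynomials of the two summands average to `1 - p (1 - p) u² / 2`.
  have key : bernChar p u - Real.exp (-(p * (1 - p) * u ^ 2 / 2)) =
      ((1 - p : ℝ) : ℂ) * (Complex.exp ((-(p * u) : ℝ) * Complex.I) -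
        (1 + (-(p * u) : ℝ) * Complex.I - ((-(p * u) : ℝ) : ℂ) ^ 2 / 2)) +
      (p : ℂ) * (Complex.exp (((1 - p) * u : ℝ) * Complex.I) -
        (1 + ((1 - p) * u : ℝ) * Complex.I - (((1 - p) * u : ℝ) : ℂ) ^ 2 / 2)) -
      ((Real.exp (-(p * (1 - p) * u ^ 2 / 2)) - 1 - -(p * (1 - p) * u ^ 2 / 2) : ℝ) : ℂ) := by
    rw [bernChar]
    push_cast
    ring
  rw [key]
  refine (norm_sub_le _ _).trans ((add_le_add (norm_add_le _ _) r₃).trans ?_)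
  rw [norm_mul, norm_mul, Complex.norm_real, Complex.norm_real, Real.norm_of_nonneg hp₀,
    Real.norm_of_nonneg hq₀]
  nlinarith [mul_le_mul_of_nonneg_left r₁ hq₀, mul_le_mul_of_nonneg_left r₂ hp₀]

/-! ### Products of bounded factors -/

lemma norm_prod_sub_prod_le_sum {ι : Type*} (s : Finset ι) (f g : ι → ℂ)
    (hf : ∀ i, ‖f i‖ ≤ 1) (hg : ∀ i, ‖g i‖ ≤ 1) :
    ‖∏ i ∈ s, f i - ∏ i ∈ s, g i‖ ≤ ∑ i ∈ s, ‖f i - g i‖ := by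
  classical
  induction s using Finset.induction_on with
  | empty => simp
  | insert a s ha ih =>
    rw [Finset.prod_insert ha, Finset.prod_insert ha, Finset.sum_insert ha]
    have h : f a * ∏ i ∈ s, f i - g a * ∏ i ∈ s, g i =
        (f a - g a) * ∏ i ∈ s, f i + g a * (∏ i ∈ s, f i - ∏ i ∈ s, g i) := by ring
    have hprod : ‖∏ i ∈ s, f i‖ ≤ 1 := by
      rw [norm_prod]
      exact Finset.prod_le_one (fun _ _ => norm_nonneg _) fun i _ => hf i
    rw [h]
    refine (norm_add_le _ _).trans ?_
    rw [norm_mul, norm_mul]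
    exact add_le_add (mul_le_of_le_one_right (norm_nonneg _) hprod)
      ((mul_le_of_le_one_left (norm_nonneg _) (hg a)).trans ih)

/-- Gaussian approximation of a product of characteristic functions of centred Bernoulli
variables, at small arguments. -/
lemma norm_prod_bernChar_sub_exp_le {N : ℕ} {p δ : ℝ} (hp : p ∈ Set.Icc (0 : ℝ) 1)
    (u : Fin N → ℝ) (hδ : δ ≤ 1) (hu : ∀ i, |u i| ≤ δ) :
    ‖∏ i, bernChar p (u i) - Real.exp (-(p * (1 - p) * (∑ i, u i ^ 2) / 2))‖ ≤
      3 * δ * ∑ i, u i ^ 2 := by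
  have hpq₀ : 0 ≤ p * (1 - p) := mul_nonneg hp.1 (by linarith [hp.2])
  have h : ((Real.exp (-(p * (1 - p) * (∑ i, u i ^ 2) / 2)) : ℝ) : ℂ) =
      ∏ i, ((Real.exp (-(p * (1 - p) * u i ^ 2 / 2)) : ℝ) : ℂ) := by
    rw [← Complex.ofReal_prod, ← Real.exp_sum, Finset.sum_neg_distrib, Finset.mul_sum,
      Finset.sum_div]
  rw [h]
  refine (norm_prod_sub_prod_le_sum _ _ _ (fun i => norm_bernChar_le_one hp _) fun i => ?_).trans ?_
  · rw [Complex.norm_real, Real.norm_of_nonneg (Real.exp_pos _).le, Real.exp_le_one_iff,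
      neg_nonpos]
    positivity
  · rw [Finset.mul_sum]
    refine Finset.sum_le_sum fun i _ =>
      (norm_bernChar_sub_exp_le hp ((hu i).trans hδ)).trans ?_
    rw [← sq_abs (u i)]
    nlinarith [mul_le_mul_of_nonneg_right (hu i) (sq_nonneg |u i|)]

/-! ### Simple random sampling as conditioned Bernoulli sampling -/

/-- The number of treated units of the assignment `t`. -/
def numTreated {N : ℕ} (t : Fin N → Fin 2) : ℕ := (Finset.univ.filter fun i => t i = 1).card

/-- The sum of the weights `b` over the treated units of the assignment `t`. -/
def treatedSum {N : ℕ} (b : Fin N → ℝ) (t : Fin N → Fin 2) : ℝ := ∑ i with t i = 1, b i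

/-- The factor belonging to one unit, as a sum over its two treatment levels. -/
lemma bernChar_eq_sum (p u : ℝ) :
    bernChar p u = ∑ a : Fin 2, (if a = 1 then (p : ℂ) else ((1 - p : ℝ) : ℂ)) *
      Complex.exp (((((if a = 1 then 1 else 0) - p) * u : ℝ) : ℂ) * Complex.I) := by
  simp [Fin.sum_univ_two, bernChar]

lemma prod_bernChar_eq_sum {N n : ℕ} {p : ℝ} (hp : N * p = n) (b : Fin N → ℝ)
    (hb : ∑ i, b i = 0) (θ : ℝ) :
    ∏ i, bernChar p (b i + θ) = ∑ t : Fin N → Fin 2,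
      ((p : ℂ) ^ numTreated t * ((1 - p : ℝ) : ℂ) ^ (N - numTreated t) *
        Complex.exp (treatedSum b t * Complex.I)) *
          Complex.exp (θ * (((numTreated t : ℤ) - n : ℤ) : ℂ) * Complex.I) := by
  simp_rw [bernChar_eq_sum]
  rw [Finset.prod_univ_sum, Fintype.piFinset_univ]
  refine Finset.sum_congr rfl fun t _ => ?_
  have hweights : ∏ i, (if t i = 1 then (p : ℂ) else ((1 - p : ℝ) : ℂ)) =
      (p : ℂ) ^ numTreated t * ((1 - p : ℝ) : ℂ) ^ (N - numTreated t) := by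
    rw [Finset.prod_ite, Finset.prod_const, Finset.prod_const]
    have := Finset.card_filter_add_card_filter_not (s := (Finset.univ : Finset (Fin N)))
      (fun i => t i = 1)
    rw [Finset.card_univ, Fintype.card_fin] at this
    congr 2
    unfold numTreated
    omega
  -- The centring `p` contributes `-p ∑ b = 0` and `-N p θ = -n θ`.
  have hexponent : ∑ i, ((if t i = 1 then 1 else 0) - p) * (b i + θ) =
      treatedSum b t + θ * (numTreated t - n) := by
    have h₁ : treatedSum b t = ∑ i, (if t i = 1 then 1 else 0) * b i := by
      simp [treatedSum, Finset.sum_filter]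
    have h₂ : (numTreated t : ℝ) = ∑ i, (if t i = 1 then 1 else 0) := by
      simp [numTreated]
    have h₃ : ∑ i, ((if t i = 1 then 1 else 0) - p) * (b i + θ) =
        ∑ i, (if t i = 1 then 1 else 0) * b i + θ * ∑ i, (if t i = 1 then 1 else 0) -
          p * ∑ i, b i - ∑ _i : Fin N, p * θ := by
      rw [Finset.mul_sum, Finset.mul_sum, ← Finset.sum_add_distrib, ← Finset.sum_sub_distrib,
        ← Finset.sum_sub_distrib]
      exact Finset.sum_congr rfl fun i _ => by ring
    rw [h₃, ← h₁, ← h₂, hb, Finset.sum_const, Finset.card_univ, Fintype.card_fin, nsmul_eq_mul,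
      ← hp]
    ring
  rw [Finset.prod_mul_distrib, hweights, ← Complex.exp_sum, ← Finset.sum_mul,
    ← Complex.ofReal_sum, hexponent, mul_assoc, mul_assoc, mul_assoc, ← Complex.exp_add]
  push_cast
  ring_nf

lemma integral_exp_int_mul_I (m : ℤ) :
    ∫ θ in (-Real.pi)..Real.pi, Complex.exp (θ * (m : ℂ) * Complex.I) =
      if m = 0 then (2 * Real.pi : ℂ) else 0 := by
  split_ifs with h
  · subst h
    simp
    ring
  · have hc : (m : ℂ) * Complex.I ≠ 0 := by simp [h]
    simp_rw [mul_assoc, mul_comm (Complex.ofReal _) ((m : ℂ) * Complex.I)]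
    rw [integral_exp_mul_complex hc, div_eq_zero_iff]
    left
    rw [sub_eq_zero]
    refine Complex.exp_eq_exp_iff_exists_int.2 ⟨m, ?_⟩
    push_cast
    ring

/-- Integrating over the auxiliary frequency `θ` extracts the assignments with exactly `n` treated
units from the product over independent Bernoulli units. -/
lemma integral_prod_bernChar {N n : ℕ} {p : ℝ} (hp : N * p = n) (b : Fin N → ℝ)
    (hb : ∑ i, b i = 0) :
    ∫ θ in (-Real.pi)..Real.pi, ∏ i, bernChar p (b i + θ) =
      2 * Real.pi * ((p : ℂ) ^ n * ((1 - p : ℝ) : ℂ) ^ (N - n)) *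
        ∑ t : Fin N → Fin 2 with numTreated t = n, Complex.exp (treatedSum b t * Complex.I) := by
  simp_rw [prod_bernChar_eq_sum hp b hb]
  rw [intervalIntegral.integral_finsetSum
    fun t _ => (Continuous.intervalIntegrable (by fun_prop) _ _)]
  simp_rw [intervalIntegral.integral_const_mul, integral_exp_int_mul_I]
  rw [Finset.mul_sum, Finset.sum_filter]
  refine Finset.sum_congr rfl fun t _ => ?_
  by_cases h : numTreated t = n
  · simp [h]
    ring
  · have : (numTreated t : ℤ) - n ≠ 0 := by omega
    simp [h, this]

namespace CRExperiment

variable (E : CRExperiment)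

lemma mem_assignments {t : Fin E.N → Fin 2} : t ∈ E.assignments ↔ numTreated t = E.N₁ := Iff.rfl

lemma assignments_eq_coe :
    E.assignments =
      ((Finset.univ.filter fun t : Fin E.N → Fin 2 => numTreated t = E.N₁ : Finset _) :
        Set (Fin E.N → Fin 2)) := by
  ext t
  simp [mem_assignments]

/-- Expectations under the randomization law are averages over the admissible assignments. -/
lemma integral_law {F : Type*} [NormedAddCommGroup F] [NormedSpace ℝ F] [CompleteSpace F]
    (g : (Fin E.N → Fin 2) → F) :
    ∫ t, g t ∂E.law =
      ((Finset.univ.filter fun t : Fin E.N → Fin 2 => numTreated t = E.N₁).card : ℝ)⁻¹ •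
        ∑ t : Fin E.N → Fin 2 with numTreated t = E.N₁, g t := by
  rw [integral_fintype Integrable.of_finite, Finset.smul_sum, Finset.sum_filter]
  refine Finset.sum_congr rfl fun t _ => ?_
  rw [law, assignments_eq_coe, measureReal_def, ← Finset.coe_singleton, uniformOn_apply_finset]
  by_cases h : numTreated t = E.N₁
  · simp [h]
  · simp [h]

lemma ae_law_iff {P : (Fin E.N → Fin 2) → Prop} :
    (∀ᵐ t ∂E.law, P t) ↔ ∀ t ∈ E.assignments, P t := by
  rw [ae_iff, law, uniformOn_eq_zero_iff (Set.toFinite _), Set.eq_empty_iff_forall_notMem]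
  simp

/-- The proportion of treated units. -/
noncomputable def propTreated : ℝ := E.N₁ / E.N

lemma N_pos : (0 : ℝ) < E.N := by exact_mod_cast E.N₁_pos.trans E.N₁_lt

lemma propTreated_mem : E.propTreated ∈ Set.Ioo (0 : ℝ) 1 := by
  have h₁ : (0 : ℝ) < E.N₁ := by exact_mod_cast E.N₁_pos
  have h₂ : (E.N₁ : ℝ) < E.N := by exact_mod_cast E.N₁_lt
  exact ⟨div_pos h₁ E.N_pos, (div_lt_one E.N_pos).2 h₂⟩

/-- The characteristic function of a centred linear statistic, as a quotient of two Fourier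
integrals; the denominator is the numerator for zero weights. -/
lemma integral_exp_treatedSum (b : Fin E.N → ℝ) (hb : ∑ i, b i = 0) :
    ∫ t, Complex.exp (treatedSum b t * Complex.I) ∂E.law =
      (∫ θ in (-Real.pi)..Real.pi, ∏ i, bernChar E.propTreated (b i + θ)) /
        ∫ θ in (-Real.pi)..Real.pi, ∏ _i : Fin E.N, bernChar E.propTreated (0 + θ) := by
  have hp : (E.N : ℝ) * E.propTreated = E.N₁ := mul_div_cancel₀ _ E.N_pos.ne'
  obtain ⟨h₀, h₁⟩ := E.propTreated_mem
  have h₂ : 1 - E.propTreated ≠ 0 := by linarith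
  rw [integral_prod_bernChar hp b hb, integral_prod_bernChar hp (fun _ => 0) (by simp),
    mul_div_mul_left, integral_law]
  · simp [treatedSum, div_eq_inv_mul]
  · have := h₀.ne'
    have := Real.pi_ne_zero
    refine mul_ne_zero (by simp) (mul_ne_zero (pow_ne_zero _ ?_) (pow_ne_zero _ ?_)) <;>
    exact_mod_cast ‹_›

end CRExperiment

/-! ### The Gaussian limit of the Fourier integrals -/

section GaussianLimit

/-- The cross term of the two squares vanishes for centred weights. -/
lemma sum_add_div_sqrt_sq {N : ℕ} (hN : 0 < N) (b : Fin N → ℝ) (hb : ∑ i, b i = 0) (s : ℝ) :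
    ∑ i, (b i + s / √N) ^ 2 = ∑ i, b i ^ 2 + s ^ 2 := by
  have hN' : (0 : ℝ) < N := by exact_mod_cast hN
  have h : ∑ i, (b i + s / √N) ^ 2 =
      ∑ i, b i ^ 2 + 2 * (s / √N) * ∑ i, b i + ∑ _i : Fin N, (s / √N) ^ 2 := by
    rw [Finset.mul_sum, ← Finset.sum_add_distrib, ← Finset.sum_add_distrib]
    exact Finset.sum_congr rfl fun i _ => by ring
  rw [h, hb, Finset.sum_const, Finset.card_univ, Fintype.card_fin, nsmul_eq_mul, div_pow,
    Real.sq_sqrt hN'.le]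
  field_simp
  ring

lemma abs_le_sqrt_div_sqrt {N : ℕ} (hN : 0 < N) {x B : ℝ} (h : N * x ^ 2 ≤ B) :
    |x| ≤ √B / √N := by
  have hN' : (0 : ℝ) < N := by exact_mod_cast hN
  rw [le_div_iff₀ (Real.sqrt_pos.2 hN'), mul_comm]
  calc √N * |x| = |√N * x| := by rw [abs_mul, abs_of_nonneg (Real.sqrt_nonneg _)]
    _ ≤ √B := Real.abs_le_sqrt (by rwa [mul_pow, Real.sq_sqrt hN'.le])

lemma sqrt_mul_intervalIntegral_eq {N : ℕ} (hN : 0 < N) (f : ℝ → ℂ) :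
    (√N : ℂ) * ∫ θ in (-Real.pi)..Real.pi, f θ =
      ∫ s, (Set.Ioc (-(Real.pi * √N)) (Real.pi * √N)).indicator (fun s => f (s / √N)) s := by
  have hN' : 0 < √(N : ℝ) := Real.sqrt_pos.2 (by exact_mod_cast hN)
  have hle : -(Real.pi * √N) ≤ Real.pi * √N := by
    have := Real.pi_pos
    have : 0 < Real.pi * √N := by positivity
    linarith
  rw [integral_indicator measurableSet_Ioc, ← intervalIntegral.integral_of_le hle,
    intervalIntegral.integral_comp_div f hN'.ne', neg_div, mul_div_cancel_right₀ _ hN'.ne',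
    Complex.real_smul]

lemma tendsto_sqrt_natCast {N : ℕ → ℕ} (hN : Tendsto N atTop atTop) :
    Tendsto (fun k => √(N k : ℝ)) atTop atTop :=
  Real.tendsto_sqrt_atTop.comp (tendsto_natCast_atTop_atTop.comp hN)

variable {N : ℕ → ℕ} {p : ℕ → ℝ} {c v B : ℝ} {b : ∀ k, Fin (N k) → ℝ}

lemma tendsto_prod_bernChar (hN : Tendsto N atTop atTop) (hp : ∀ k, p k ∈ Set.Icc (0 : ℝ) 1)
    (hpc : Tendsto p atTop (𝓝 c)) (hb : ∀ᶠ k in atTop, ∑ i, b k i = 0)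
    (hv : Tendsto (fun k => ∑ i, b k i ^ 2) atTop (𝓝 v))
    (hB : ∀ᶠ k in atTop, ∀ i, N k * b k i ^ 2 ≤ B) (s : ℝ) :
    Tendsto (fun k => ∏ i, bernChar (p k) (b k i + s / √(N k))) atTop
      (𝓝 ((Real.exp (-(c * (1 - c) * (v + s ^ 2) / 2)) : ℝ) : ℂ)) := by
  have hδ : Tendsto (fun k => (√B + |s|) / √(N k)) atTop (𝓝 0) :=
    tendsto_const_nhds.div_atTop (tendsto_sqrt_natCast hN)
  have hsum : Tendsto (fun k => ∑ i, b k i ^ 2 + s ^ 2) atTop (𝓝 (v + s ^ 2)) :=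
    hv.add tendsto_const_nhds
  have hexp : Tendsto (fun k =>
      ((Real.exp (-(p k * (1 - p k) * (∑ i, b k i ^ 2 + s ^ 2) / 2)) : ℝ) : ℂ)) atTop
      (𝓝 ((Real.exp (-(c * (1 - c) * (v + s ^ 2) / 2)) : ℝ) : ℂ)) := by
    refine (Complex.continuous_ofReal.tendsto _).comp ((Real.continuous_exp.tendsto _).comp ?_)
    exact (((hpc.mul (tendsto_const_nhds.sub hpc)).mul hsum).div_const 2).neg
  have hdiff : Tendsto (fun k => ∏ i, bernChar (p k) (b k i + s / √(N k)) -
      ((Real.exp (-(p k * (1 - p k) * (∑ i, b k i ^ 2 + s ^ 2) / 2)) : ℝ) : ℂ)) atTop (𝓝 0) := by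
    have hlim : Tendsto (fun k => 3 * ((√B + |s|) / √(N k)) * (∑ i, b k i ^ 2 + s ^ 2)) atTop
        (𝓝 0) := by
      simpa using (hδ.const_mul 3).mul hsum
    refine squeeze_zero_norm' ?_ hlim
    filter_upwards [hb, hB, hN.eventually_gt_atTop 0, hδ.eventually_le_const zero_lt_one]
      with k hbk hBk hNk hδk
    rw [← sum_add_div_sqrt_sq hNk (b k) hbk s]
    refine norm_prod_bernChar_sub_exp_le (hp k) _ hδk fun i => (abs_add_le _ _).trans ?_
    rw [abs_div, abs_of_nonneg (Real.sqrt_nonneg (N k : ℝ)), add_div]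
    exact add_le_add_left (abs_le_sqrt_div_sqrt hNk (hBk i)) _
  simpa using hdiff.add hexp

/-- Gaussian domination of the product, uniform over the whole rescaled period. -/
lemma eventually_norm_prod_bernChar_le (hN : Tendsto N atTop atTop)
    (hp : ∀ k, p k ∈ Set.Icc (0 : ℝ) 1) (hpc : Tendsto p atTop (𝓝 c)) (hc : c ∈ Set.Ioo (0 : ℝ) 1)
    (hb : ∀ᶠ k in atTop, ∑ i, b k i = 0) (hB : ∀ᶠ k in atTop, ∀ i, N k * b k i ^ 2 ≤ B) :
    ∀ᶠ k in atTop, ∀ s : ℝ, |s| ≤ Real.pi * √(N k) →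
      ‖∏ i, bernChar (p k) (b k i + s / √(N k))‖ ≤
        Real.exp (-(c * (1 - c) / 2 * (4 / (9 * Real.pi ^ 2))) * s ^ 2) := by
  have hpi := Real.pi_pos
  have hcc : 0 < c * (1 - c) := mul_pos hc.1 (by linarith [hc.2])
  have hsmall : Tendsto (fun k => √B / √(N k)) atTop (𝓝 0) :=
    tendsto_const_nhds.div_atTop (tendsto_sqrt_natCast hN)
  have hpq : Tendsto (fun k => p k * (1 - p k)) atTop (𝓝 (c * (1 - c))) :=
    hpc.mul (tendsto_const_nhds.sub hpc)
  filter_upwards [hb, hB, hN.eventually_gt_atTop 0,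
    hsmall.eventually_le_const (half_pos hpi), hpq.eventually_const_le (half_lt_self hcc)]
    with k hbk hBk hNk hδk hpqk s hs
  have hNk' : 0 < √(N k : ℝ) := Real.sqrt_pos.2 (by exact_mod_cast hNk)
  have hu : ∀ i, |b k i + s / √(N k)| ≤ 3 * Real.pi / 2 := fun i => by
    have h₁ := (abs_le_sqrt_div_sqrt hNk (hBk i)).trans hδk
    have h₂ : |s / √(N k)| ≤ Real.pi := by
      rwa [abs_div, abs_of_nonneg hNk'.le, div_le_iff₀ hNk']
    linarith [abs_add_le (b k i) (s / √(N k))]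
  rw [norm_prod]
  refine (Finset.prod_le_prod (fun _ _ => norm_nonneg _)
    fun i _ => norm_bernChar_le_exp (hp k) (hu i)).trans ?_
  rw [← Real.exp_sum, Real.exp_le_exp, Finset.sum_neg_distrib, ← Finset.mul_sum,
    sum_add_div_sqrt_sq hNk (b k) hbk s, neg_mul, neg_le_neg_iff]
  have hS : 0 ≤ ∑ i, b k i ^ 2 := Finset.sum_nonneg fun i _ => sq_nonneg _
  exact mul_le_mul (mul_le_mul_of_nonneg_right hpqk (by positivity)) (by linarith) (sq_nonneg s)
    (mul_nonneg ((half_pos hcc).le.trans hpqk) (by positivity))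

lemma tendsto_sqrt_mul_integral_prod_bernChar (hN : Tendsto N atTop atTop)
    (hp : ∀ k, p k ∈ Set.Icc (0 : ℝ) 1) (hpc : Tendsto p atTop (𝓝 c)) (hc : c ∈ Set.Ioo (0 : ℝ) 1)
    (hb : ∀ᶠ k in atTop, ∑ i, b k i = 0)
    (hv : Tendsto (fun k => ∑ i, b k i ^ 2) atTop (𝓝 v))
    (hB : ∀ᶠ k in atTop, ∀ i, N k * b k i ^ 2 ≤ B) :
    Tendsto (fun k => (√(N k) : ℂ) *
        ∫ θ in (-Real.pi)..Real.pi, ∏ i, bernChar (p k) (b k i + θ)) atTop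
      (𝓝 ((Real.exp (-(c * (1 - c) * v / 2)) * √(Real.pi / (c * (1 - c) / 2)) : ℝ) : ℂ)) := by
  have hpi := Real.pi_pos
  have hcc : 0 < c * (1 - c) := mul_pos hc.1 (by linarith [hc.2])
  have hlimit : ((Real.exp (-(c * (1 - c) * v / 2)) * √(Real.pi / (c * (1 - c) / 2)) : ℝ) : ℂ) =
      ∫ s : ℝ, ((Real.exp (-(c * (1 - c) * (v + s ^ 2) / 2)) : ℝ) : ℂ) := by
    rw [integral_complex_ofReal, ← integral_gaussian, ← integral_const_mul]
    congr 1
    refine integral_congr_ae (ae_of_all _ fun s => ?_)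
    simp only [← Real.exp_add]
    ring_nf
  have heq : (fun k => (√(N k) : ℂ) *
      ∫ θ in (-Real.pi)..Real.pi, ∏ i, bernChar (p k) (b k i + θ)) =ᶠ[atTop] fun k =>
      ∫ s, (Set.Ioc (-(Real.pi * √(N k))) (Real.pi * √(N k))).indicator
        (fun s => ∏ i, bernChar (p k) (b k i + s / √(N k))) s := by
    filter_upwards [hN.eventually_gt_atTop 0] with k hk
    exact sqrt_mul_intervalIntegral_eq hk fun θ => ∏ i, bernChar (p k) (b k i + θ)
  rw [hlimit]
  refine Tendsto.congr' heq.symm ?_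
  refine tendsto_integral_filter_of_dominated_convergence
    (fun s => Real.exp (-(c * (1 - c) / 2 * (4 / (9 * Real.pi ^ 2))) * s ^ 2)) ?_ ?_
    (integrable_exp_neg_mul_sq (by positivity)) (ae_of_all _ fun s => ?_)
  · refine Eventually.of_forall fun k => (Continuous.aestronglyMeasurable ?_).indicator
      measurableSet_Ioc
    exact continuous_finsetProd _ fun i _ => (continuous_bernChar _).comp (by fun_prop)
  · filter_upwards [eventually_norm_prod_bernChar_le hN hp hpc hc hb hB] with k hk
    refine ae_of_all _ fun s => ?_
    by_cases hs : s ∈ Set.Ioc (-(Real.pi * √(N k))) (Real.pi * √(N k))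
    · rw [Set.indicator_of_mem hs]
      exact hk s (abs_le.2 ⟨hs.1.le, hs.2⟩)
    · rw [Set.indicator_of_notMem hs, norm_zero]
      positivity
  · refine (tendsto_prod_bernChar hN hp hpc hb hv hB s).congr' ?_
    have hlarge := ((tendsto_sqrt_natCast hN).const_mul_atTop hpi).eventually_gt_atTop |s|
    filter_upwards [hlarge] with k hk
    rw [Set.indicator_of_mem]
    exact ⟨(abs_lt.1 hk).1, (abs_lt.1 hk).2.le⟩

end GaussianLimit

namespace CRExperiment

/-- The finite-population central limit theorem, in terms of characteristic functions. -/
lemma tendsto_integral_exp_treatedSum {E : ℕ → CRExperiment} {c v B : ℝ}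
    (hN : Tendsto (fun k => (E k).N) atTop atTop) (hc : c ∈ Set.Ioo (0 : ℝ) 1)
    (hpc : Tendsto (fun k => (E k).propTreated) atTop (𝓝 c)) (b : ∀ k, Fin (E k).N → ℝ)
    (hb : ∀ k, ∑ i, b k i = 0) (hv : Tendsto (fun k => ∑ i, b k i ^ 2) atTop (𝓝 v))
    (hB : ∀ᶠ k in atTop, ∀ i, (E k).N * b k i ^ 2 ≤ B) :
    Tendsto (fun k => ∫ t, Complex.exp (treatedSum (b k) t * Complex.I) ∂(E k).law) atTop
      (𝓝 ((Real.exp (-(c * (1 - c) * v / 2)) : ℝ) : ℂ)) := by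
  have hpi := Real.pi_pos
  have hcc : 0 < c * (1 - c) := mul_pos hc.1 (by linarith [hc.2])
  have hp : ∀ k, (E k).propTreated ∈ Set.Icc (0 : ℝ) 1 :=
    fun k => Set.Ioo_subset_Icc_self (E k).propTreated_mem
  have hnum := tendsto_sqrt_mul_integral_prod_bernChar hN hp hpc hc (.of_forall hb) hv hB
  have hden := tendsto_sqrt_mul_integral_prod_bernChar (N := fun k => (E k).N) (v := 0) (B := 0)
    (b := fun k _ => 0) hN hp hpc hc (by simp) (by simp) (by simp)
  have hK : √(Real.pi / (c * (1 - c) / 2)) ≠ 0 := (Real.sqrt_pos.2 (by positivity)).ne'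
  have hlim := hnum.div hden (by simpa using hK)
  rw [← Complex.ofReal_div, mul_zero, zero_div, neg_zero, Real.exp_zero, one_mul,
    mul_div_cancel_right₀ _ hK] at hlim
  refine hlim.congr fun k => ?_
  have hsqrt : (√((E k).N : ℝ) : ℂ) ≠ 0 := by
    exact_mod_cast (Real.sqrt_pos.2 (E k).N_pos).ne'
  rw [integral_exp_treatedSum _ _ (hb k)]
  exact mul_div_mul_left _ _ hsqrt

end CRExperiment

/-! ### Moments under complete randomization -/

/-- The indicator of unit `i` being treated, as a real number. -/
def treatedInd {N : ℕ} (t : Fin N → Fin 2) (i : Fin N) : ℝ := if t i = 1 then 1 else 0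

lemma sum_treatedInd {N : ℕ} (t : Fin N → Fin 2) : ∑ i, treatedInd t i = numTreated t := by
  simp [treatedInd, numTreated]

lemma treatedSum_eq_sum_mul {N : ℕ} (b : Fin N → ℝ) (t : Fin N → Fin 2) :
    treatedSum b t = ∑ i, b i * treatedInd t i := by
  simp [treatedSum, treatedInd, Finset.sum_filter]

lemma treatedInd_mul_self {N : ℕ} (t : Fin N → Fin 2) (i : Fin N) :
    treatedInd t i * treatedInd t i = treatedInd t i := by
  simp [treatedInd]

lemma numTreated_comp_perm {N : ℕ} (t : Fin N → Fin 2) (σ : Equiv.Perm (Fin N)) :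
    numTreated (t ∘ σ) = numTreated t := by
  have h := Equiv.sum_comp σ (treatedInd t)
  rw [sum_treatedInd] at h
  exact_mod_cast (sum_treatedInd (t ∘ σ)).symm.trans h

namespace CRExperiment

variable (E : CRExperiment)

/-- The randomization law is exchangeable. -/
lemma integral_law_comp_perm (σ : Equiv.Perm (Fin E.N)) (g : (Fin E.N → Fin 2) → ℝ) :
    ∫ t, g (t ∘ σ) ∂E.law = ∫ t, g t ∂E.law := by
  rw [integral_law, integral_law]
  congr 1
  refine Finset.sum_equiv (σ.symm.arrowCongr (Equiv.refl _)) (fun t => ?_) fun t _ => rfl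
  have h : (σ.symm.arrowCongr (Equiv.refl (Fin 2))) t = t ∘ σ := rfl
  simp [h, numTreated_comp_perm]

lemma ae_sum_treatedInd : ∀ᵐ t ∂E.law, ∑ i, treatedInd t i = E.N₁ :=
  E.ae_law_iff.2 fun t ht => by rw [sum_treatedInd, E.mem_assignments.1 ht]

lemma integral_treatedInd (i : Fin E.N) : ∫ t, treatedInd t i ∂E.law = E.N₁ / E.N := by
  have hsymm : ∀ j, ∫ t, treatedInd t j ∂E.law = ∫ t, treatedInd t i ∂E.law := fun j => by
    rw [← E.integral_law_comp_perm (Equiv.swap i j) fun t => treatedInd t i]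
    simp [treatedInd]
  have hsum : ∑ j, ∫ t, treatedInd t j ∂E.law = E.N₁ := by
    rw [← integral_finsetSum _ fun _ _ => Integrable.of_finite,
      integral_congr_ae E.ae_sum_treatedInd]
    simp
  simp_rw [hsymm] at hsum
  rw [Finset.sum_const, Finset.card_univ, Fintype.card_fin, nsmul_eq_mul] at hsum
  rw [eq_div_iff E.N_pos.ne', mul_comm, hsum]

lemma one_lt_N : (1 : ℝ) < E.N := by
  have h₁ := E.N₁_pos
  have h₂ := E.N₁_lt
  exact_mod_cast (by omega : 1 < E.N)

/-- Summing over `i` for fixed `j` gives `∑ᵢ TᵢTⱼ = N₁ Tⱼ`, and by exchangeability the off-diagonal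
terms have equal expectations. -/
lemma integral_treatedInd_mul {i j : Fin E.N} (hij : i ≠ j) :
    ∫ t, treatedInd t i * treatedInd t j ∂E.law =
      (E.N₁ : ℝ) / E.N * ((E.N₁ - 1) / (E.N - 1)) := by
  have hsymm : ∀ k ∈ Finset.univ.erase j, ∫ t, treatedInd t k * treatedInd t j ∂E.law =
      ∫ t, treatedInd t i * treatedInd t j ∂E.law := fun k hk => by
    have hkj := Finset.ne_of_mem_erase hk
    rw [← E.integral_law_comp_perm (Equiv.swap i k) fun t => treatedInd t i * treatedInd t j]
    simp [treatedInd, Equiv.swap_apply_of_ne_of_ne hij.symm hkj.symm]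
  have hsum : ∑ k, ∫ t, treatedInd t k * treatedInd t j ∂E.law = E.N₁ * (E.N₁ / E.N) := by
    rw [← integral_finsetSum _ fun _ _ => Integrable.of_finite, ← E.integral_treatedInd j,
      ← integral_const_mul]
    refine integral_congr_ae (E.ae_sum_treatedInd.mono fun t ht => ?_)
    simp only [← Finset.sum_mul, ht]
  rw [← Finset.add_sum_erase _ _ (Finset.mem_univ j), Finset.sum_congr rfl hsymm,
    Finset.sum_const, Finset.card_erase_of_mem (Finset.mem_univ j), Finset.card_univ,
    Fintype.card_fin, nsmul_eq_mul] at hsum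
  simp_rw [treatedInd_mul_self] at hsum
  have hN := E.one_lt_N
  rw [integral_treatedInd, Nat.cast_sub (by exact_mod_cast hN.le), Nat.cast_one] at hsum
  have h₁ : (E.N : ℝ) - 1 ≠ 0 := by linarith
  have h₂ : (E.N : ℝ) ≠ 0 := by linarith
  rw [← mul_div_assoc, eq_div_iff h₁]
  linear_combination hsum

lemma integral_treatedSum (b : Fin E.N → ℝ) (hb : ∑ i, b i = 0) :
    ∫ t, treatedSum b t ∂E.law = 0 := by
  simp_rw [treatedSum_eq_sum_mul]
  rw [integral_finsetSum _ fun _ _ => Integrable.of_finite]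
  simp_rw [integral_const_mul, integral_treatedInd]
  rw [← Finset.sum_mul, hb, zero_mul]

lemma cast_N₀ : (E.N₀ : ℝ) = E.N - E.N₁ := by
  rw [N₀, Nat.cast_sub E.N₁_lt.le]

lemma integral_treatedSum_sq (b : Fin E.N → ℝ) (hb : ∑ i, b i = 0) :
    ∫ t, treatedSum b t ^ 2 ∂E.law =
      (E.N₁ : ℝ) * E.N₀ / (E.N * (E.N - 1)) * ∑ i, b i ^ 2 := by
  have hN := E.one_lt_N
  have h₁ : (E.N : ℝ) - 1 ≠ 0 := by linarith
  have h₂ : (E.N : ℝ) ≠ 0 := by linarith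
  have hcov : ∀ i j, ∫ t, treatedInd t i * treatedInd t j ∂E.law =
      (E.N₁ : ℝ) / E.N * ((E.N₁ - 1) / (E.N - 1)) +
        if i = j then (E.N₁ : ℝ) * E.N₀ / (E.N * (E.N - 1)) else 0 := fun i j => by
    split_ifs with hij
    · subst hij
      simp_rw [treatedInd_mul_self]
      rw [integral_treatedInd, cast_N₀]
      field_simp
      ring
    · rw [add_zero, E.integral_treatedInd_mul hij]
  have hexpand : ∀ t : Fin E.N → Fin 2, treatedSum b t ^ 2 =
      ∑ i, ∑ j, b i * b j * (treatedInd t i * treatedInd t j) := fun t => by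
    rw [treatedSum_eq_sum_mul, sq, Finset.sum_mul_sum]
    exact Finset.sum_congr rfl fun i _ => Finset.sum_congr rfl fun j _ => by ring
  simp_rw [hexpand]
  rw [integral_finsetSum _ fun _ _ => Integrable.of_finite]
  simp_rw [integral_finsetSum Finset.univ fun _ _ => Integrable.of_finite, integral_const_mul,
    hcov, mul_add, Finset.sum_add_distrib]
  simp_rw [← Finset.sum_mul, ← Finset.sum_mul_sum]
  rw [hb, Finset.mul_sum]
  simp only [mul_ite, mul_zero, zero_mul, zero_add, Finset.sum_ite_eq, Finset.mem_univ, if_true]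
  exact Finset.sum_congr rfl fun i _ => by ring

/-! ### The difference in means as a linear statistic -/

lemma sum_sub_popMean (y : Fin E.N → ℝ) : ∑ i, (y i - popMean y) = 0 := by
  rw [Finset.sum_sub_distrib, Finset.sum_const, Finset.card_univ, Fintype.card_fin, nsmul_eq_mul,
    popMean, mul_div_cancel₀ _ E.N_pos.ne', sub_self]

lemma N₁_cast_pos : (0 : ℝ) < E.N₁ := by exact_mod_cast E.N₁_pos

lemma N₀_cast_pos : (0 : ℝ) < E.N₀ := by
  rw [cast_N₀, sub_pos]
  exact_mod_cast E.N₁_lt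

lemma diffInMeans_eq {t : Fin E.N → Fin 2} (ht : t ∈ E.assignments) (y : Fin E.N → ℝ) :
    E.diffInMeans t y =
      E.N / (E.N₁ * E.N₀) * treatedSum (fun i => y i - popMean y) t := by
  have h₀ : ∑ i with t i = 0, y i = ∑ i, y i - treatedSum y t := by
    rw [treatedSum, ← Finset.sum_filter_add_sum_filter_not Finset.univ (fun i => t i = 1),
      add_sub_cancel_left]
    refine Finset.sum_congr (Finset.filter_congr fun i _ => ?_) fun _ _ => rfl
    generalize t i = a
    fin_cases a <;> simp
  have h₁ : treatedSum (fun i => y i - popMean y) t = treatedSum y t - E.N₁ * popMean y := by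
    rw [treatedSum, Finset.sum_sub_distrib, Finset.sum_const, nsmul_eq_mul,
      ← E.mem_assignments.1 ht]
    rfl
  have hN := E.N_pos.ne'
  have hN₁ := E.N₁_cast_pos.ne'
  have hN₀ := E.N₀_cast_pos.ne'
  rw [diffInMeans, h₀, h₁, popMean, ← treatedSum]
  field_simp
  rw [cast_N₀]
  ring

variable {E}

lemma SharpNull.Yobs_eq (h : E.SharpNull) (t : Fin E.N → Fin 2) : E.Yobs t = E.Y 1 := by
  funext i
  have : ∀ a : Fin 2, E.Y a i = E.Y 1 i := by
    intro a
    fin_cases a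
    · exact (h i).symm
    · rfl
  exact this (t i)

variable (E)

lemma integral_diffInMeans (y : Fin E.N → ℝ) : ∫ t, E.diffInMeans t y ∂E.law = 0 := by
  rw [integral_congr_ae (E.ae_law_iff.2 fun t ht => E.diffInMeans_eq ht y), integral_const_mul,
    E.integral_treatedSum _ (E.sum_sub_popMean y), mul_zero]

lemma variance_diffInMeans (y : Fin E.N → ℝ) :
    variance (fun t => E.diffInMeans t y) E.law = E.fisherVar y := by
  rw [variance_of_integral_eq_zero (Measurable.of_discrete).aemeasurable
    (E.integral_diffInMeans y)]
  have h : ∀ᵐ t ∂E.law, E.diffInMeans t y ^ 2 = (E.N / (E.N₁ * E.N₀) : ℝ) ^ 2 *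
      treatedSum (fun i => y i - popMean y) t ^ 2 :=
    E.ae_law_iff.2 fun t ht => by rw [E.diffInMeans_eq ht y, mul_pow]
  have hN := E.N_pos.ne'
  have hN₁ := E.N₁_cast_pos.ne'
  have hN₀ := E.N₀_cast_pos.ne'
  have hN' : (E.N : ℝ) - 1 ≠ 0 := by linarith [E.one_lt_N]
  rw [integral_congr_ae h, integral_const_mul,
    E.integral_treatedSum_sq _ (E.sum_sub_popMean y), fisherVar, popVar]
  field_simp

/-! ### Asymptotic normality -/

/-- The weights for which the standardized difference in means of `y` is the sum over the treated
units. -/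
noncomputable def stdWeight (y : Fin E.N → ℝ) (i : Fin E.N) : ℝ :=
  E.N / (E.N₁ * E.N₀) / √(E.fisherVar y) * (y i - popMean y)

lemma sum_stdWeight (y : Fin E.N → ℝ) : ∑ i, E.stdWeight y i = 0 := by
  simp_rw [stdWeight]
  rw [← Finset.mul_sum, sum_sub_popMean, mul_zero]

lemma diffInMeans_div_sqrt {t : Fin E.N → Fin 2} (ht : t ∈ E.assignments) (y : Fin E.N → ℝ) :
    E.diffInMeans t y / √(E.fisherVar y) = treatedSum (E.stdWeight y) t := by
  rw [E.diffInMeans_eq ht, treatedSum, treatedSum, Finset.mul_sum, Finset.sum_div]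
  exact Finset.sum_congr rfl fun i _ => by rw [stdWeight]; ring

lemma sum_stdWeight_sq {y : Fin E.N → ℝ} (hy : 0 < ∑ i, (y i - popMean y) ^ 2) :
    ∑ i, E.stdWeight y i ^ 2 =
      (1 - (E.N : ℝ)⁻¹) / (E.propTreated * (1 - E.propTreated)) := by
  have hN := E.N_pos
  have hN₁ := E.N₁_cast_pos
  have hN₀ := E.N₀_cast_pos
  have hN' : 0 < (E.N : ℝ) - 1 := by linarith [E.one_lt_N]
  have hV : 0 ≤ E.fisherVar y := by
    rw [fisherVar, popVar]
    positivity
  have hq : 1 - E.propTreated = E.N₀ / E.N := by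
    rw [propTreated, cast_N₀]
    field_simp
  simp_rw [stdWeight, mul_pow]
  rw [← Finset.mul_sum, div_pow, Real.sq_sqrt hV, fisherVar, popVar, hq, propTreated]
  field_simp

lemma N_mul_stdWeight_sq {y : Fin E.N → ℝ} (hy : 0 < ∑ i, (y i - popMean y) ^ 2) (i : Fin E.N) :
    E.N * E.stdWeight y i ^ 2 = (∑ j, E.stdWeight y j ^ 2) *
      ((y i - popMean y) ^ 2 / ((∑ j, (y j - popMean y) ^ 2) / E.N)) := by
  have hN := E.N_pos.ne'
  simp_rw [stdWeight, mul_pow]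
  rw [← Finset.mul_sum]
  generalize ((E.N : ℝ) / (E.N₁ * E.N₀) / √(E.fisherVar y)) ^ 2 = a
  field_simp

/-- Asymptotic normality of the standardized difference in means of a sequence of fixed outcome
vectors. -/
lemma tendstoInDistribution_diffInMeans {E : ℕ → CRExperiment} {c : ℝ}
    (y : ∀ k, Fin (E k).N → ℝ) (hN : Tendsto (fun k => (E k).N) atTop atTop)
    (hc : c ∈ Set.Ioo (0 : ℝ) 1) (hpc : Tendsto (fun k => (E k).propTreated) atTop (𝓝 c))
    (hy : BoundedMaxRatio y) :
    TendstoInDistribution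
      (fun k t => (E k).diffInMeans t (y k) / √((E k).fisherVar (y k)))
      atTop (id : ℝ → ℝ) (fun k => (E k).law) (gaussianReal 0 1) where
  forall_aemeasurable k := (Measurable.of_discrete).aemeasurable
  tendsto := by
    obtain ⟨B, hB⟩ := hy
    have hcc : 0 < c * (1 - c) := mul_pos hc.1 (by linarith [hc.2])
    have hv : Tendsto (fun k => ∑ i, (E k).stdWeight (y k) i ^ 2) atTop
        (𝓝 (c * (1 - c))⁻¹) := by
      have hlim : Tendsto (fun k => (1 - ((E k).N : ℝ)⁻¹) /
          ((E k).propTreated * (1 - (E k).propTreated))) atTop (𝓝 ((1 - 0) / (c * (1 - c)))) :=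
        (tendsto_const_nhds.sub (tendsto_inv_atTop_zero.comp
          (tendsto_natCast_atTop_atTop.comp hN))).div
            (hpc.mul (tendsto_const_nhds.sub hpc)) hcc.ne'
      rw [sub_zero, one_div] at hlim
      refine hlim.congr' ?_
      filter_upwards [hB] with k hk
      exact ((E k).sum_stdWeight_sq hk.1).symm
    refine ProbabilityMeasure.tendsto_iff_tendsto_charFun.2 fun τ => ?_
    simp only [ProbabilityMeasure.coe_mk, Measure.map_id, charFun_gaussianReal]
    have hlim := tendsto_integral_exp_treatedSum hN hc hpc
      (fun k i => τ * (E k).stdWeight (y k) i) (v := τ ^ 2 * (c * (1 - c))⁻¹)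
      (B := τ ^ 2 * (((c * (1 - c))⁻¹ + 1) * |B|))
      (fun k => by rw [← Finset.mul_sum, sum_stdWeight, mul_zero])
      (by simpa only [mul_pow, ← Finset.mul_sum] using hv.const_mul (τ ^ 2))
      (by
        filter_upwards [hB, hv.eventually_le_const (lt_add_one _)] with k hk hvk i
        rw [mul_pow, mul_left_comm, (E k).N_mul_stdWeight_sq hk.1]
        have h₀ : 0 ≤ ∑ j, (E k).stdWeight (y k) j ^ 2 :=
          Finset.sum_nonneg fun _ _ => sq_nonneg _
        exact mul_le_mul_of_nonneg_left
          (mul_le_mul hvk ((hk.2 i).trans (le_abs_self B))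
            (div_nonneg (sq_nonneg _) (div_nonneg hk.1.le (Nat.cast_nonneg _)))
            (h₀.trans hvk)) (sq_nonneg τ))
    have hval : ((Real.exp (-(c * (1 - c) * (τ ^ 2 * (c * (1 - c))⁻¹) / 2)) : ℝ) : ℂ) =
        Complex.exp (τ * (0 : ℝ) * Complex.I - ((1 : NNReal) : ℝ) * τ ^ 2 / 2) := by
      rw [mul_left_comm, mul_inv_cancel₀ hcc.ne']
      push_cast
      ring_nf
    rw [hval] at hlim
    refine hlim.congr fun k => ?_
    rw [charFun_apply_real, integral_map (Measurable.of_discrete).aemeasurable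
      (by fun_prop)]
    refine integral_congr_ae ((E k).ae_law_iff.2 fun t ht => ?_)
    simp only [(E k).diffInMeans_div_sqrt ht, treatedSum, ← Finset.mul_sum, Complex.ofReal_mul]

end CRExperiment

theorem theorem2 :
    -- exact mean and variance of the randomization statistic under the sharp null
    (∀ E : CRExperiment, E.SharpNull →
      (∫ t, E.diffInMeans t (E.Yobs t) ∂E.law) = 0 ∧
      ∀ t₀ ∈ E.assignments,
        variance (fun t => E.diffInMeans t (E.Yobs t)) E.law = E.fisherVar (E.Yobs t₀)) ∧
    -- asymptotic normality along a sequence of experiments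
    (∀ (E : ℕ → CRExperiment) (c : ℝ),
      (∀ k, (E k).SharpNull) →
      Tendsto (fun k => (E k).N) atTop atTop →
      c ∈ Set.Ioo (0 : ℝ) 1 →
      Tendsto (fun k => ((E k).N₁ : ℝ) / (E k).N) atTop (𝓝 c) →
      -- under the sharp null, `(E k).Y 1` is the vector of observed outcomes
      BoundedMaxRatio (fun k => (E k).Y 1) →
      TendstoInDistribution
        (fun k t => (E k).diffInMeans t ((E k).Yobs t) / √((E k).fisherVar ((E k).Yobs t)))
        atTop (id : ℝ → ℝ) (fun k => (E k).law) (gaussianReal 0 1)) := by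
  refine ⟨fun E hE => ?_, fun E c hE hN hc hpc hB => ?_⟩
  · simp_rw [hE.Yobs_eq]
    exact ⟨E.integral_diffInMeans _, fun _ _ => E.variance_diffInMeans _⟩
  · simp_rw [(hE _).Yobs_eq]
    exact CRExperiment.tendstoInDistribution_diffInMeans _ hN hc hpc hB
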